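/- For $n\ge 0$ let $\mathcal S_{2n}$ be the symmetric group of $[2n]$. For $\omega\in\mathcal S_{2n}$ let $\Gamma(\omega)$ be the graph with vertex set $[2n]$ in which, for each $k\le n$, the vertices $2k-1$ and $2k$ are joined by an edge, and likewise the vertices $\omega^{-1}(2k-1)$ and $\omega^{-1}(2k)$. It is a disjoint union of cycles of even lengths $2\mu_1\ge 2\mu_2\ge\cdots$ (a double edge being a cycle of length $2$), and the partition $\mu$ of $n$ is called the coset-type of $\omega$. For a partition $\mu$ of $n$ let $\mathbf K_\mu\in\mathbb C[\mathcal S_{2n}]$ be the sum of all permutations of coset-type $\mu$; these elements form a basis of the Hecke algebra of the pair $(\mathcal S_{2n},\mathcal B_n)$, where $\mathcal B_n$ is the hyperoctahedral group. A partition $\lambda$ is called proper if no part of it equals $1$; $|\lambda|$ is its size, $l(\lambda)$ its number of parts, and, for $n\ge|\lambda|$, $\underline\lambda_n=\lambda\cup(1^{n-|\lambda|})$. For proper partitions $\lambda,\delta$ and $n\ge|\lambda|,|\delta|$ define the structure coefficients $\alpha_{\lambda\delta}^{\tau}(n)$ by $$\mathbf K_{\underline\lambda_n}\mathbf K_{\underline\delta_n}=\sum_{\tau\text{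 proper},\,|\tau|\le n}\alpha_{\lambda\delta}^{\tau}(n)\,\mathbf K_{\underline\tau_n}.$$ **Proposition.** Let $\lambda,\delta,\rho$ be proper partitions. There is a unique polynomial $f_{\lambda\delta}^{\rho}\in\mathbb Q[x]$ such that $\alpha_{\lambda\delta}^{\rho}(n)=2^n\,n!\,f_{\lambda\delta}^{\rho}(n)$ for all $n\ge\max(|\lambda|,|\delta|,|\rho|)$, and its degree satisfies $$\deg f_{\lambda\delta}^{\rho}\le|\lambda|+|\delta|-|\rho|,$$ $$\deg f_{\lambda\delta}^{\rho}\le|\lambda|+|\delta|-|\rho|-l(\lambda)-l(\delta)+l(\rho),$$ with the convention $\deg 0=-\infty$ (so $f_{\lambda\delta}^{\rho}=0$ if one of the right-hand sides is negative). -/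

import Mathlib

open Polynomial

namespace HyperoctahedralHecke

/-- A partition is proper if none of its parts equals `1` (the empty partition is proper). -/
def IsProper {a : ℕ} (lam : a.Partition) : Prop := 1 ∉ lam.parts

/-- The partition `λ ∪ (1^(n-|λ|))` of `n`, for `|λ| = a ≤ n`. -/
def complete {a n : ℕ} (lam : a.Partition) (h : a ≤ n) : n.Partition where
  parts := lam.parts + Multiset.replicate (n - a) 1
  parts_pos := by
    intro i hi
    rcases Multiset.mem_add.1 hi with hi | hi
    · exact lam.parts_pos hi
    · rw [Multiset.eq_of_mem_replicate hi]
      exact Nat.one_pos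
  parts_sum := by
    simp [lam.parts_sum, h]

/-- The graph `Γ(ω)` of a permutation `ω` of `2n` points. The points are numbered from `0`, so that
the pairs are `{2k, 2k+1}` and two points lie in the same pair when their halves agree. Two distinct
points `i`, `j` are joined if `i`, `j` form a pair or if their images under `ω` form a pair. -/
def cosetGraph {n : ℕ} (w : Equiv.Perm (Fin (2 * n))) : SimpleGraph (Fin (2 * n)) :=
  SimpleGraph.fromRel fun i j =>
    (i : ℕ) / 2 = (j : ℕ) / 2 ∨ (w i : ℕ) / 2 = (w j : ℕ) / 2

open Classical in
/-- The coset-type of `ω`: the multiset of half the sizes of the cycles (the connected components)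
of `Γ(ω)`. -/
noncomputable def cosetType {n : ℕ} (w : Equiv.Perm (Fin (2 * n))) : Multiset ℕ :=
  (Finset.univ : Finset (cosetGraph w).ConnectedComponent).val.map fun C => C.supp.ncard / 2

open Classical in
/-- `K_λ`, the sum in the group algebra `ℂ[S_{2n}]` of all permutations of coset-type `λ`. -/
noncomputable def classSum {n : ℕ} (lam : n.Partition) :
    MonoidAlgebra ℂ (Equiv.Perm (Fin (2 * n))) :=
  ∑ w : Equiv.Perm (Fin (2 * n)) with cosetType w = lam.parts, MonoidAlgebra.of ℂ _ w

/-- `z` is the structure coefficient `α_{λδ}^ρ` of the Hecke algebra of `(S_{2n}, B_n)`: the product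
`K_λ K_δ` has exactly one expansion `∑_τ α_τ K_τ` over the partitions `τ` of `n`, and the
coefficient of `K_ρ` in it is `z`. -/
def IsStructureCoeff {n : ℕ} (lam del rho : n.Partition) (z : ℂ) : Prop :=
  ∃ α : n.Partition → ℂ,
    (∀ β : n.Partition → ℂ,
      classSum lam * classSum del = ∑ τ : n.Partition, β τ • classSum τ ↔ β = α) ∧
    α rho = z

/-- `f` is the polynomial describing the structure coefficient `α_{λδ}^ρ(n)`:
`α_{λδ}^ρ(n) = 2^n n! f(n)` for all `n` for which the completions of `λ`, `δ`, `ρ` to partitions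
of `n` exist. -/
def IsStructurePolynomial {a b c : ℕ} (lam : a.Partition) (del : b.Partition) (rho : c.Partition)
    (f : ℚ[X]) : Prop :=
  ∀ (n : ℕ) (ha : a ≤ n) (hb : b ≤ n) (hc : c ≤ n),
    IsStructureCoeff (complete lam ha) (complete del hb) (complete rho hc)
      (2 ^ n * (n.factorial : ℂ) * ((f.eval (n : ℚ) : ℚ) : ℂ))

end HyperoctahedralHecke

/-!
Write `M₀` for the standard matching of the `2n` points and `M₁ = w⁻¹ M₀` for the second matching
of `Γ(w)`. Encoding matchings as fixed-point-free involutions `s`, `t`, a cycle of length `2k` of the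
graph of two matchings splits into two cycles of length `k` of `s * t`. Hence the coset-type of `w`
is `λ ∪ (1^(n-|λ|))` exactly when the cycle type of `s * t` is `λ ∪ λ`
(`cosetType_eq_complete_iff`), and this cycle type classifies pairs of matchings up to relabelling
(`IsMatching.exists_equiv`). Both facts come from a normal form: the graph of two matchings is
bipartite, so the pair lives on `ι ⊕ ι`, with `s` exchanging the two copies and `t` given by a
permutation of `ι`.

The coefficient of `w` in `K_λ K_δ` counts the `y` for which `w y⁻¹` has type `λ` and `y` has type
`δ`. The map `y ↦ y⁻¹ M₀` has fibres of size `2^n n!`, so the coefficient is `2^n n!` times the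
number of matchings `N` such that `M₀, N` have type `δ` and `N, M₁` have type `λ`
(`coeff_mul_eq_card_interpolants`). It depends on the coset-type of `w` only.

If `M₀, M₁` have type `ρ`, such an `N` is obtained from a configuration on `|ρ| + j` edges without
edges common to all three matchings, by adding common edges: `(n - |ρ|).choose j` choices
(`card_interpolants_eq_sum`). The number of these configurations does not depend on `n`, and it
vanishes for large `j`, so the count is a polynomial in `n` whose degree is at most the largest `j`
that occurs.

On a configuration without common edges every point is moved by `s * N` or by `N * t`. Comparing
supports gives the first degree bound. The second is an inequality for permutations `σ`, `τ` that
together move every point: the number of points is at most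
`rank σ + rank τ + #(nontrivial cycles of σ * τ)`, where the rank is the number of points minus the
number of orbits (`card_add_card_cycleType_le`). It is applied to `σ = s * N`, `τ = N * t`, whose
product is `s * t`. It is proved by moving transpositions from `τ` to `σ` until `τ = 1`: the product
is unchanged, the sum of the ranks does not grow, and it drops by two whenever a point stops being
moved.
-/

namespace HyperoctahedralHecke

open Equiv Equiv.Perm Finset

/-! ### Orbits of a permutation and the rank inequality -/

section Orbits

open scoped Classical

variable {α : Type*} [Fintype α] [DecidableEq α]

theorem orbit_card_of_mem_support (σ : Perm α) (x : α) (hx : σ x ≠ x) :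
    #{y | (⟦y⟧ : Quotient (SameCycle.setoid σ)) = ⟦x⟧} = #(σ.cycleOf x).support := by
  congr 1
  ext y
  rw [mem_support_cycleOf_iff' hx, mem_filter, Quotient.eq]
  simp only [mem_univ, true_and]
  exact sameCycle_comm

theorem cycleType_eq_map_orbit_card (σ : Perm α) :
    σ.cycleType = (univ.filter fun q : Quotient (SameCycle.setoid σ) => σ q.out ≠ q.out).val.map
      fun q => #{x | (⟦x⟧ : Quotient (SameCycle.setoid σ)) = q} := by
  have himg : σ.cycleFactorsFinset =
      (univ.filter fun q : Quotient (SameCycle.setoid σ) => σ q.out ≠ q.out).image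
        fun q => σ.cycleOf q.out := by
    ext f
    simp only [mem_image, mem_filter, mem_univ, true_and]
    constructor
    · intro hf
      obtain ⟨x, hx⟩ := IsCycle.nonempty_support (mem_cycleFactorsFinset_iff.mp hf).1
      have hs : SameCycle σ (⟦x⟧ : Quotient (SameCycle.setoid σ)).out x :=
        Quotient.mk_out (s := SameCycle.setoid σ) x
      have hfx := cycle_is_cycleOf hx hf
      refine ⟨⟦x⟧, ?_, ?_⟩
      · rw [Ne, hs.apply_eq_self_iff]
        have := mem_cycleFactorsFinset_support_le hf hx
        exact mem_support.1 this
      · rw [hfx, hs.cycleOf_eq]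
    · rintro ⟨q, hq, rfl⟩
      exact cycleOf_mem_cycleFactorsFinset_iff.2 (mem_support.2 hq)
  have hinj : Set.InjOn (fun q : Quotient (SameCycle.setoid σ) => σ.cycleOf q.out)
      (univ.filter fun q : Quotient (SameCycle.setoid σ) => σ q.out ≠ q.out) := by
    intro q hq r hr h
    simp only [coe_filter, mem_univ, true_and, Set.mem_ofPred_eq] at hq hr
    rw [← Quotient.out_eq q, ← Quotient.out_eq r, Quotient.eq]
    exact (sameCycle_iff_cycleOf_eq_of_mem_support (mem_support.2 hq) (mem_support.2 hr)).2 h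
  rw [cycleType_def, himg, image_val_of_injOn hinj, Multiset.map_map]
  refine Multiset.map_congr rfl fun q hq => ?_
  have hq' : σ q.out ≠ q.out := (mem_filter.1 hq).2
  have := orbit_card_of_mem_support σ q.out hq'
  rw [Quotient.out_eq] at this
  simp [this]

/-- The orbit sizes of a permutation, fixed points included, are the parts of its partition. -/
theorem map_orbit_card (σ : Perm α) :
    (univ : Finset (Quotient (SameCycle.setoid σ))).val.map
      (fun q => #{x | (⟦x⟧ : Quotient (SameCycle.setoid σ)) = q}) = σ.partition.parts := by
  rw [parts_partition]
  have hsplit := Multiset.filter_add_not (fun q : Quotient (SameCycle.setoid σ) =>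
    σ q.out ≠ q.out) univ.val
  rw [← hsplit, Multiset.map_add, ← filter_val, ← cycleType_eq_map_orbit_card, ← filter_val]
  congr 1
  have hone : ∀ q ∈ (univ.filter fun q : Quotient (SameCycle.setoid σ) => ¬ σ q.out ≠ q.out).val,
      #{x | (⟦x⟧ : Quotient (SameCycle.setoid σ)) = q} = 1 := by
    intro q hq
    have hq' : σ q.out = q.out := not_not.1 (mem_filter.1 hq).2
    rw [card_eq_one]
    refine ⟨q.out, ?_⟩
    ext x
    simp only [mem_filter, mem_univ, true_and, mem_singleton]
    constructor
    · rintro rfl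
      have h : SameCycle σ x (⟦x⟧ : Quotient (SameCycle.setoid σ)).out := 
        SameCycle.symm (Quotient.mk_out (s := SameCycle.setoid σ) x)
      exact (h.symm.eq_of_left hq').symm
    · rintro rfl
      exact Quotient.out_eq q
  have hsum : ∑ q : Quotient (SameCycle.setoid σ),
      #{x | (⟦x⟧ : Quotient (SameCycle.setoid σ)) = q} = Fintype.card α := by
    rw [← card_univ]
    exact (card_eq_sum_card_fiberwise fun x _ => mem_univ _).symm
  rw [Multiset.map_congr rfl hone, Multiset.map_const']
  congr 1
  rw [← sum_filter_add_sum_filter_not univ (fun q : Quotient (SameCycle.setoid σ) =>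
    σ q.out ≠ q.out)] at hsum
  have h1 : ∑ q : Quotient (SameCycle.setoid σ) with σ q.out ≠ q.out,
      #{x | (⟦x⟧ : Quotient (SameCycle.setoid σ)) = q} = #σ.support := by
    rw [← sum_cycleType, cycleType_eq_map_orbit_card]
    rfl
  rw [h1, sum_congr rfl hone, sum_const, smul_eq_mul, mul_one] at hsum
  rw [card_val]
  omega

/-- The number of orbits of a permutation, fixed points included. -/
noncomputable def orbitCount (σ : Perm α) : ℕ := Fintype.card (Quotient (SameCycle.setoid σ))

theorem orbitCount_add_card_support (σ : Perm α) :
    orbitCount σ + #σ.support = σ.cycleType.card + Fintype.card α := by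
  have h := congrArg Multiset.card (map_orbit_card σ)
  rw [parts_partition] at h
  simp only [Multiset.card_map, card_val, Multiset.card_add, Multiset.card_replicate,
    card_univ] at h
  have := σ.support.card_le_univ
  unfold orbitCount
  omega

/-- A map that is constant on the orbits of `σ` takes at most `orbitCount σ` values. -/
theorem card_image_le_orbitCount {α β : Type*} [Fintype α] [DecidableEq β] (σ : Perm α) (f : α → β)
    (hf : ∀ x, f (σ x) = f x) : #(univ.image f) ≤ orbitCount σ := by
  have hz : ∀ x y, SameCycle σ x y → f x = f y := by
    rintro x y ⟨k, rfl⟩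
    induction k generalizing x with
    | zero => rfl
    | succ k ih => rw [zpow_add_one, Perm.mul_apply, ← ih, hf]
    | pred k ih =>
      rw [zpow_sub_one, Perm.mul_apply, ← ih, ← hf (σ⁻¹ x), coe_inv, apply_symm_apply]
  have : univ.image f ⊆ (univ : Finset (Quotient (SameCycle.setoid σ))).image
      (Quotient.lift f hz) := by
    intro b hb
    obtain ⟨x, -, rfl⟩ := mem_image.1 hb
    exact mem_image.2 ⟨⟦x⟧, mem_univ _, rfl⟩
  exact (card_le_card this).trans card_image_le

/-- Multiplication by a transposition merges at most two orbits into one. -/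
theorem orbitCount_le_orbitCount_mul_swap_add_one (σ : Perm α) (x y : α) :
    orbitCount σ ≤ orbitCount (σ * swap x y) + 1 := by
  set p : α → Quotient (SameCycle.setoid σ) := fun z => ⟦z⟧
  have hpσ : ∀ z, p (σ z) = p z := fun z => Quotient.sound (sameCycle_apply_left.2 (SameCycle.refl _ _))
  -- glue the orbit of `y` to the orbit of `x`
  let g : Quotient (SameCycle.setoid σ) → Quotient (SameCycle.setoid σ) :=
    fun q => if q = p y then p x else q
  have hg : ∀ z, g (p ((σ * swap x y) z)) = g (p z) := by
    intro z
    rw [Perm.mul_apply, hpσ]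
    rcases eq_or_ne z x with rfl | hzx
    · rw [swap_apply_left]; simp only [g]; split_ifs <;> simp_all
    rcases eq_or_ne z y with rfl | hzy
    · rw [swap_apply_right]; simp only [g]; split_ifs <;> simp_all
    rw [swap_apply_of_ne_of_ne hzx hzy]
  have h := card_image_le_orbitCount (σ * swap x y) (fun z => g (p z)) hg
  have hsub : univ.erase (p y) ⊆ univ.image fun z => g (p z) := by
    intro q hq
    obtain ⟨z, rfl⟩ := Quotient.exists_rep q
    exact mem_image.2 ⟨z, mem_univ _, if_neg (mem_erase.1 hq).1⟩
  have h2 := card_le_card hsub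
  rw [card_erase_of_mem (mem_univ _), card_univ] at h2
  unfold orbitCount at *
  omega

/-- A transposition inside an orbit of `σ` refines the partition into orbits. -/
theorem orbitCount_le_orbitCount_mul_swap (σ : Perm α) {x y : α} (h : SameCycle σ x y) :
    orbitCount σ ≤ orbitCount (σ * swap x y) := by
  set p : α → Quotient (SameCycle.setoid σ) := fun z => ⟦z⟧
  have hpσ : ∀ z, p (σ z) = p z := fun z => Quotient.sound (sameCycle_apply_left.2 (SameCycle.refl _ _))
  have hxy : p x = p y := Quotient.sound h
  have hg : ∀ z, p ((σ * swap x y) z) = p z := by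
    intro z
    rw [Perm.mul_apply, hpσ]
    rcases eq_or_ne z x with rfl | hzx
    · rw [swap_apply_left, hxy]
    rcases eq_or_ne z y with rfl | hzy
    · rw [swap_apply_right, hxy]
    rw [swap_apply_of_ne_of_ne hzx hzy]
  have h := card_image_le_orbitCount (σ * swap x y) p hg
  rwa [image_univ_of_surjective Quotient.mk_surjective, card_univ] at h

/-- The parity of the orbit count is the sign, up to a constant. -/
theorem orbitCount_mul_swap_ne (σ : Perm α) {x y : α} (hxy : x ≠ y) :
    orbitCount (σ * swap x y) ≠ orbitCount σ := by
  intro h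
  have h1 := orbitCount_add_card_support σ
  have h2 := orbitCount_add_card_support (σ * swap x y)
  have hs : sign (σ * swap x y) = -sign σ := by rw [Perm.sign_mul, sign_swap hxy, mul_neg_one]
  have he : (-1 : ℤˣ) ^ (#(σ * swap x y).support + (σ * swap x y).cycleType.card) =
      (-1) ^ (#σ.support + σ.cycleType.card) := by
    apply neg_one_pow_congr
    rw [Nat.even_iff, Nat.even_iff]
    omega
  rw [← sum_cycleType, ← sum_cycleType, ← sign_of_cycleType, ← sign_of_cycleType, hs] at he
  exact units_ne_neg_self _ he.symm

theorem orbitCount_lt_orbitCount_mul_swap (σ : Perm α) {x y : α} (h : SameCycle σ x y)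
    (hxy : x ≠ y) : orbitCount σ < orbitCount (σ * swap x y) :=
  lt_of_le_of_ne (orbitCount_le_orbitCount_mul_swap σ h) (orbitCount_mul_swap_ne σ hxy).symm

/-- The rank inequality for arbitrary `σ` and `τ`, by induction on the support of `τ`: a
transposition that splits a point off a cycle of `τ` is absorbed by `σ`, so that `σ * τ` does not
change. -/
theorem card_union_support_add_orbitCount_le (σ τ : Perm α) :
    #(σ.support ∪ τ.support) + orbitCount σ + orbitCount τ ≤
      2 * Fintype.card α + (σ * τ).cycleType.card := by
  induction hn : #τ.support using Nat.strong_induction_on generalizing σ τ with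
  | _ n ih =>
  subst hn
  by_cases hτ : τ = 1
  · subst hτ
    have h1 := orbitCount_add_card_support σ
    have h2 := orbitCount_add_card_support (1 : Perm α)
    simp only [support_one, card_empty, cycleType_one, Multiset.card_zero, union_empty, mul_one]
      at h2 ⊢
    omega
  obtain ⟨x, hx⟩ : ∃ x, τ x ≠ x := by
    by_contra! h
    exact hτ (Perm.ext h)
  have hprod : σ * swap x (τ x) * (swap x (τ x) * τ) = σ * τ := by
    rw [mul_assoc, ← mul_assoc (swap x (τ x)), swap_mul_self, one_mul]
  have hlt : #(swap x (τ x) * τ).support < #τ.support := card_support_swap_mul hx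
  have hI := ih _ hlt (σ * swap x (τ x)) (swap x (τ x) * τ) rfl
  rw [hprod] at hI
  have hτ' : orbitCount τ < orbitCount (swap x (τ x) * τ) := by
    have : swap x (τ x) * τ = τ * swap (τ.symm x) x := by
      rw [mul_swap_eq_swap_mul, apply_symm_apply]
    rw [this]
    refine orbitCount_lt_orbitCount_mul_swap τ ?_ ?_
    · exact sameCycle_symm_apply_left.2 (SameCycle.refl _ _)
    · intro h
      exact hx (by rw [symm_apply_eq] at h; exact h.symm)
  have hmoved : ∀ z, z ≠ x → z ≠ τ x → z ∈ σ.support ∪ τ.support →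
      z ∈ (σ * swap x (τ x)).support ∪ (swap x (τ x) * τ).support := by
    intro z hzx hzy hz
    simp only [mem_union, mem_support, Perm.mul_apply] at hz ⊢
    rw [swap_apply_of_ne_of_ne hzx hzy]
    refine hz.imp id fun hz => ?_
    intro h
    rw [swap_apply_eq_iff, swap_apply_of_ne_of_ne hzx hzy] at h
    exact hz h
  by_cases hs : SameCycle σ x (τ x)
  -- at most two points stop being moved, and both orbit counts grow
  · have hσ' := orbitCount_lt_orbitCount_mul_swap σ hs hx.symm
    have hsub : σ.support ∪ τ.support ⊆
        ((σ * swap x (τ x)).support ∪ (swap x (τ x) * τ).support) ∪ {x, τ x} := by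
      intro z hz
      by_cases h : z = x ∨ z = τ x
      · exact mem_union_right _ (by simpa using h)
      · push Not at h
        exact mem_union_left _ (hmoved z h.1 h.2 hz)
    have h1 := (card_le_card hsub).trans (card_union_le _ _)
    have h2 : #{x, τ x} ≤ 2 := card_le_two
    omega
  -- no point stops being moved, and the orbits of `τ` gain what those of `σ` may lose
  · have hσ' := orbitCount_le_orbitCount_mul_swap_add_one σ x (τ x)
    have hsub : σ.support ∪ τ.support ⊆
        (σ * swap x (τ x)).support ∪ (swap x (τ x) * τ).support := by
      intro z hz
      by_cases hzx : z = x
      · refine mem_union_left _ (mem_support.2 ?_)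
        subst hzx
        rw [Perm.mul_apply, swap_apply_left]
        intro h
        exact hs (by rw [← sameCycle_apply_right, h])
      by_cases hzy : z = τ x
      · refine mem_union_left _ (mem_support.2 ?_)
        subst hzy
        rw [Perm.mul_apply, swap_apply_right]
        intro h
        exact hs (by rw [← h, sameCycle_apply_right])
      exact hmoved z hzx hzy hz
    have h1 := card_le_card hsub
    omega

/-- Two permutations that together move every point: the number of points is bounded by the ranks
of the permutations and the number of nontrivial cycles of their product. -/
theorem card_add_card_cycleType_le (σ τ : Perm α) (h : ∀ x, σ x = x → τ x ≠ x) :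
    Fintype.card α + σ.cycleType.card + τ.cycleType.card ≤
      #σ.support + #τ.support + (σ * τ).cycleType.card := by
  have hu : σ.support ∪ τ.support = univ := by
    ext x
    simp only [mem_union, mem_support, mem_univ, iff_true]
    exact or_iff_not_imp_left.2 fun hx => h x (not_not.1 hx)
  have h0 := card_union_support_add_orbitCount_le σ τ
  have h1 := orbitCount_add_card_support σ
  have h2 := orbitCount_add_card_support τ
  rw [hu, card_univ] at h0
  omega

end Orbits

/-! ### Pairs of perfect matchings -/

section Matchings

variable {α β : Type*}

/-- A perfect matching, encoded as the fixed-point-free involution that exchanges the two points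
of each edge. -/
def IsMatching (s : Perm α) : Prop := (∀ x, s (s x) = x) ∧ ∀ x, s x ≠ x

theorem IsMatching.mul_self {s : Perm α} (hs : IsMatching s) : s * s = 1 := Perm.ext hs.1

theorem IsMatching.inv_eq {s : Perm α} (hs : IsMatching s) : s⁻¹ = s :=
  inv_eq_of_mul_eq_one_right hs.mul_self

theorem IsMatching.mul_inv {s t : Perm α} (hs : IsMatching s) (ht : IsMatching t) :
    (s * t)⁻¹ = t * s := by rw [_root_.mul_inv_rev, hs.inv_eq, ht.inv_eq]

theorem IsMatching.permCongr {s : Perm α} (hs : IsMatching s) (e : α ≃ β) :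
    IsMatching (e.permCongr s) := by
  constructor
  · intro x; simp [hs.1]
  · intro x h
    rw [permCongr_apply, ← eq_symm_apply] at h
    exact hs.2 _ h

theorem IsMatching.conj {s : Perm α} (hs : IsMatching s) (g : Perm α) :
    IsMatching (g * s * g⁻¹) := by
  have : g * s * g⁻¹ = Equiv.permCongr g s := by ext x; simp
  rw [this]
  exact hs.permCongr g

/-- `s` conjugates `s * t` to its inverse. -/
theorem IsMatching.apply_zpow_mul {s t : Perm α} (hs : IsMatching s) (ht : IsMatching t) (k : ℤ)
    (x : α) : s (((s * t) ^ k) x) = ((s * t) ^ (-k)) (s x) := by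
  have h : s * (s * t) * s⁻¹ = (s * t)⁻¹ := by
    rw [hs.mul_inv ht, hs.inv_eq, ← mul_assoc, hs.mul_self, one_mul]
  have h2 : s * (s * t) ^ k * s⁻¹ = (s * t) ^ (-k) := by
    rw [← conj_zpow, h, inv_zpow, zpow_neg]
  rw [← h2]
  simp

/-- No point is joined to its partner by a power of `s * t`: every cycle of two matchings has even
length. A fixed point of `s` or of `t` would otherwise sit half way between them. -/
theorem IsMatching.not_sameCycle {s t : Perm α} (hs : IsMatching s) (ht : IsMatching t) (x : α) :
    ¬ SameCycle (s * t) x (s x) := by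
  rintro ⟨k, hk⟩
  rcases Int.even_or_odd' k with ⟨m, rfl | rfl⟩
  · apply hs.2 (((s * t) ^ m) x)
    rw [hs.apply_zpow_mul ht, ← hk, ← Perm.mul_apply, ← zpow_add]
    congr 2
    ring
  · apply ht.2 (((s * t) ^ m) x)
    have h1 : s (((s * t) ^ m) x) = ((s * t) ^ (m + 1)) x := by
      rw [hs.apply_zpow_mul ht, ← hk, ← Perm.mul_apply, ← zpow_add]
      congr 2
      ring
    have h2 : t (((s * t) ^ m) x) = s (((s * t) ^ (m + 1)) x) := by
      rw [add_comm, zpow_one_add, Perm.mul_apply, Perm.mul_apply, hs.1]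
    rw [h2, ← h1, hs.1]

/-- The graph formed by two matchings is bipartite. -/
theorem IsMatching.exists_coloring {s t : Perm α} (hs : IsMatching s) (ht : IsMatching t) :
    ∃ T : Set α, (∀ x, s x ∈ T ↔ x ∉ T) ∧ ∀ x, t x ∈ T ↔ x ∉ T := by
  classical
  have hflip : ∀ x y, SameCycle (s * t) (s x) y → SameCycle (s * t) x (s y) := by
    rintro x y ⟨k, rfl⟩
    refine ⟨-k, ?_⟩
    rw [hs.apply_zpow_mul ht, hs.1]
  -- the components of the graph
  let r : Setoid α :=
    { r := fun x y => SameCycle (s * t) x y ∨ SameCycle (s * t) (s x) y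
      iseqv := by
        refine ⟨fun x => Or.inl (SameCycle.refl _ _), ?_, ?_⟩
        · rintro x y (h | h)
          · exact Or.inl h.symm
          · exact Or.inr (hflip _ _ h).symm
        · rintro x y z (h | h) (h' | h')
          · exact Or.inl (h.trans h')
          · exact Or.inr ((hflip (s x) y (by rwa [hs.1])).trans h')
          · exact Or.inr (h.trans h')
          · exact Or.inl ((hflip _ _ h).trans h') }
  have hout : ∀ x, SameCycle (s * t) (⟦x⟧ : Quotient r).out x ∨
      SameCycle (s * t) (s (⟦x⟧ : Quotient r).out) x := fun x => Quotient.mk_out (s := r) x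
  have hq : ∀ x, (⟦s x⟧ : Quotient r) = ⟦x⟧ := fun x =>
    Quotient.sound (s := r) (Or.inr (by rw [hs.1]))
  have key : ∀ x, s x ∈ {x | SameCycle (s * t) (⟦x⟧ : Quotient r).out x} ↔
      x ∉ {x | SameCycle (s * t) (⟦x⟧ : Quotient r).out x} := by
    intro x
    simp only [Set.mem_ofPred_eq, hq]
    constructor
    · intro h1 h2
      exact hs.not_sameCycle ht x (h2.symm.trans h1)
    · intro h
      exact hflip _ _ ((hout x).resolve_left h)
  refine ⟨_, key, fun x => ?_⟩
  rw [← key]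
  have hst : (⟦t x⟧ : Quotient r) = ⟦x⟧ :=
    Quotient.sound (s := r) (Or.inr (sameCycle_apply_left.2 (SameCycle.refl _ x)))
  have hsx : s x = (s * t) (t x) := by rw [Perm.mul_apply, ht.1]
  simp only [Set.mem_ofPred_eq, hq, hst]
  rw [hsx, sameCycle_apply_right]

/-- The matching of `ι ⊕ ι` that joins the two copies of each element. -/
def baseMatching (ι : Type*) : Perm (ι ⊕ ι) := Equiv.sumComm ι ι

/-- The matching of `ι ⊕ ι` that joins the left copy of `i` to the right copy of `π i`. -/
def twistedMatching {ι : Type*} (π : Perm ι) : Perm (ι ⊕ ι) :=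
  baseMatching ι * Perm.sumCongr π π⁻¹

variable {ι κ : Type*}

@[simp] theorem baseMatching_inl (i : ι) : baseMatching ι (.inl i) = .inr i := rfl
@[simp] theorem baseMatching_inr (i : ι) : baseMatching ι (.inr i) = .inl i := rfl
@[simp] theorem twistedMatching_inl (π : Perm ι) (i : ι) :
    twistedMatching π (.inl i) = .inr (π i) := rfl
@[simp] theorem twistedMatching_inr (π : Perm ι) (i : ι) :
    twistedMatching π (.inr i) = .inl (π⁻¹ i) := rfl

theorem isMatching_baseMatching : IsMatching (baseMatching ι) :=
  ⟨by rintro (i | i) <;> rfl, by rintro (i | i) <;> simp⟩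

theorem isMatching_twistedMatching (π : Perm ι) : IsMatching (twistedMatching π) :=
  ⟨by rintro (i | i) <;> simp, by rintro (i | i) <;> simp⟩

theorem baseMatching_mul_twistedMatching (π : Perm ι) :
    baseMatching ι * twistedMatching π = Perm.sumCongr π π⁻¹ := by
  rw [twistedMatching, ← mul_assoc, isMatching_baseMatching.mul_self, one_mul]

theorem cycleType_sumCongr [Fintype ι] [DecidableEq ι] [Fintype κ] [DecidableEq κ] (π : Perm ι)
    (π' : Perm κ) : (Perm.sumCongr π π').cycleType = π.cycleType + π'.cycleType := by
  classical
  have h1 : Perm.sumCongr π (1 : Perm κ) =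
      π.extendDomain (Equiv.ofInjective (Sum.inl : ι → ι ⊕ κ) Sum.inl_injective) := by
    ext x : 1
    rcases x with i | i
    · exact (extendDomain_apply_image π (Equiv.ofInjective (Sum.inl : ι → ι ⊕ κ)
        Sum.inl_injective) i).symm
    · rw [extendDomain_apply_not_subtype _ _ (by simp)]; rfl
  have h2 : Perm.sumCongr (1 : Perm ι) π' =
      π'.extendDomain (Equiv.ofInjective (Sum.inr : κ → ι ⊕ κ) Sum.inr_injective) := by
    ext x : 1
    rcases x with i | i
    · rw [extendDomain_apply_not_subtype _ _ (by simp)]; rfl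
    · exact (extendDomain_apply_image π' (Equiv.ofInjective (Sum.inr : κ → ι ⊕ κ)
        Sum.inr_injective) i).symm
  have h : Perm.sumCongr π π' = Perm.sumCongr π 1 * Perm.sumCongr 1 π' := by
    ext x : 1
    rcases x with i | i <;> rfl
  have hd : Perm.Disjoint (Perm.sumCongr π (1 : Perm κ)) (Perm.sumCongr 1 π') := by
    rintro (i | i)
    · exact Or.inr rfl
    · exact Or.inl rfl
  rw [h, hd.cycleType_mul]
  congr 1
  · rw [h1, cycleType_extendDomain]
  · rw [h2, cycleType_extendDomain]

theorem cycleType_baseMatching_mul_twistedMatching [Fintype ι] [DecidableEq ι] (π : Perm ι) :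
    (baseMatching ι * twistedMatching π).cycleType = π.cycleType + π.cycleType := by
  rw [baseMatching_mul_twistedMatching, cycleType_sumCongr, cycleType_inv]

/-- Normal form of a pair of matchings: along a bipartition, one becomes the base matching and the
other is described by a permutation of the edges of the first. -/
theorem IsMatching.exists_normal_form [Fintype α] {s t : Perm α} (hs : IsMatching s)
    (ht : IsMatching t) {n : ℕ} (hn : Fintype.card α = 2 * n) :
    ∃ (π : Perm (Fin n)) (e : α ≃ Fin n ⊕ Fin n),
      e.permCongr s = baseMatching _ ∧ e.permCongr t = twistedMatching π := by
  classical
  obtain ⟨T, hsT, htT⟩ := hs.exists_coloring ht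
  let e₁ : T ≃ (Tᶜ : Set α) :=
    { toFun := fun x => ⟨s x, fun h => (hsT _).1 h x.2⟩
      invFun := fun x => ⟨s x, (hsT _).2 x.2⟩
      left_inv := fun x => Subtype.ext (hs.1 _)
      right_inv := fun x => Subtype.ext (hs.1 _) }
  have hT : Fintype.card T = n := by
    have h1 := Fintype.card_congr e₁
    have h2 := Fintype.card_compl_set T
    have h3 := set_fintype_card_le_univ T
    omega
  let u : T ≃ Fin n := Fintype.equivFinOfCardEq hT
  let e : Fin n ⊕ Fin n ≃ α :=
    (Equiv.sumCongr u.symm (u.symm.trans e₁)).trans (Equiv.Set.sumCompl T)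
  have hl : ∀ i, e (.inl i) = u.symm i := fun i => rfl
  have hr : ∀ i, e (.inr i) = s (u.symm i) := fun i => rfl
  let p : Perm T :=
    { toFun := fun x => ⟨s (t x), (hsT _).2 fun h => (htT _).1 h x.2⟩
      invFun := fun x => ⟨t (s x), (htT _).2 fun h => (hsT _).1 h x.2⟩
      left_inv := fun x => Subtype.ext (by simp [hs.1, ht.1])
      right_inv := fun x => Subtype.ext (by simp [hs.1, ht.1]) }
  refine ⟨u.permCongr p, e.symm, ?_, ?_⟩
  · ext x : 1
    rw [permCongr_apply, symm_symm, symm_apply_eq]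
    rcases x with i | i
    · rw [hl, baseMatching_inl, hr]
    · rw [hr, baseMatching_inr, hl, hs.1]
  · ext x : 1
    rw [permCongr_apply, symm_symm, symm_apply_eq]
    rcases x with i | i
    · rw [hl, twistedMatching_inl, hr, permCongr_apply, symm_apply_apply]
      change _ = s (s (t (u.symm i)))
      rw [hs.1]
    · rw [hr, twistedMatching_inr, hl]
      have : (u.permCongr p)⁻¹ i = u (p.symm (u.symm i)) := rfl
      rw [this, symm_apply_apply]
      rfl

theorem twistedMatching_permCongr (π : Perm ι) (u : ι ≃ κ) :
    (Equiv.sumCongr u u).permCongr (twistedMatching π) = twistedMatching (u.permCongr π) := by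
  ext x : 1
  rcases x with i | i <;> rfl

theorem baseMatching_permCongr (u : ι ≃ κ) :
    (Equiv.sumCongr u u).permCongr (baseMatching ι) = baseMatching κ := by
  ext x : 1
  rcases x with i | i <;> simp

theorem permCongr_mul (e : α ≃ β) (s t : Perm α) :
    e.permCongr (s * t) = e.permCongr s * e.permCongr t := by
  ext x; simp

theorem cycleType_permCongr [Fintype α] [DecidableEq α] [Fintype β] [DecidableEq β] (e : α ≃ β)
    (s : Perm α) : (e.permCongr s).cycleType = s.cycleType := by
  have : e.permCongr s = s.extendDomain (e.trans (Equiv.subtypeUnivEquiv (p := fun _ : β => True)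
      fun _ => trivial).symm) := by
    ext x
    rw [extendDomain_apply_subtype _ _ trivial]
    rfl
  rw [this, cycleType_extendDomain]

theorem eq_of_add_self_eq {R S : Multiset α} (h : R + R = S + S) : R = S := by
  classical
  ext k
  have := congrArg (Multiset.count k) h
  simp only [Multiset.count_add] at this
  omega

theorem IsMatching.exists_normal_form_of_cycleType [Fintype α] [DecidableEq α] {s t : Perm α}
    (hs : IsMatching s) (ht : IsMatching t) {n : ℕ} (hn : Fintype.card α = 2 * n)
    {R : Multiset ℕ} (hR : (s * t).cycleType = R + R) :
    ∃ (π : Perm (Fin n)) (e : α ≃ Fin n ⊕ Fin n),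
      e.permCongr s = baseMatching _ ∧ e.permCongr t = twistedMatching π ∧ π.cycleType = R := by
  obtain ⟨π, e, hes, het⟩ := hs.exists_normal_form ht hn
  refine ⟨π, e, hes, het, eq_of_add_self_eq ?_⟩
  rw [← cycleType_baseMatching_mul_twistedMatching, ← hR, ← cycleType_permCongr e, permCongr_mul,
    hes, het]

theorem IsMatching.cycleType_eq_replicate_card [Fintype α] [DecidableEq α] {s : Perm α}
    (hs : IsMatching s) : s.cycleType = Multiset.replicate s.cycleType.card 2 := by
  rw [Multiset.eq_replicate_card]
  intro k hk
  have h1 : k ∣ 2 := (dvd_of_mem_cycleType hk).trans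
    (orderOf_dvd_of_pow_eq_one (by rw [pow_two, hs.mul_self]))
  exact ((Nat.dvd_prime Nat.prime_two).1 h1).resolve_left
    (by have := two_le_of_mem_cycleType hk; omega)

theorem IsMatching.card_eq [Fintype α] [DecidableEq α] {s : Perm α} (hs : IsMatching s) :
    Fintype.card α = 2 * s.cycleType.card := by
  have h : #s.support = Fintype.card α := by
    rw [← card_univ]
    congr 1
    ext x
    simp [hs.2]
  rw [← h, ← sum_cycleType, hs.cycleType_eq_replicate_card, Multiset.sum_replicate,
    Multiset.card_replicate, smul_eq_mul, mul_comm]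

/-- The cycle type of the product classifies pairs of matchings. -/
theorem IsMatching.exists_equiv [Fintype α] [DecidableEq α] [Fintype β] [DecidableEq β]
    {s t : Perm α} (hs : IsMatching s) (ht : IsMatching t) {s' t' : Perm β} (hs' : IsMatching s')
    (ht' : IsMatching t') (hcard : Fintype.card α = Fintype.card β)
    (h : (s * t).cycleType = (s' * t').cycleType) :
    ∃ e : α ≃ β, e.permCongr s = s' ∧ e.permCongr t = t' := by
  have hn := hs.card_eq
  obtain ⟨π, e, hes, het⟩ := hs.exists_normal_form ht hn
  obtain ⟨π', e', hes', het'⟩ := hs'.exists_normal_form ht' (hcard ▸ hn)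
  have hπ : π.cycleType = π'.cycleType := by
    have h1 := cycleType_permCongr e (s * t)
    have h2 := cycleType_permCongr e' (s' * t')
    rw [permCongr_mul, hes, het, cycleType_baseMatching_mul_twistedMatching] at h1
    rw [permCongr_mul, hes', het', cycleType_baseMatching_mul_twistedMatching, ← h, ← h1] at h2
    exact (eq_of_add_self_eq h2).symm
  obtain ⟨g, hg⟩ := isConj_iff.1 (isConj_iff_cycleType_eq.2 hπ)
  have hg' : Equiv.permCongr g π = π' := by rw [← hg]; ext x; simp
  have hback : ∀ p : Perm β, e'.symm.permCongr (e'.permCongr p) = p := fun p => by ext; simp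
  refine ⟨(e.trans (Equiv.sumCongr g g)).trans e'.symm, ?_, ?_⟩
  · rw [← hback s', hes', ← baseMatching_permCongr g, ← hes]
    rfl
  · rw [← hback t', het', ← hg', ← twistedMatching_permCongr, ← het]
    rfl

end Matchings

/-! ### Counting interpolating matchings -/

section Counting

variable {α β : Type*} [Fintype α] [DecidableEq α] [Fintype β] [DecidableEq β]

open Classical in
/-- The matchings `N` whose types relative to `s` and to `t` are prescribed by the cycle types `D`
and `L` of the products `s * N` and `N * t`. -/
noncomputable def interpolants (s t : Perm α) (D L : Multiset ℕ) : Finset (Perm α) :=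
  {N | IsMatching N ∧ (s * N).cycleType = D ∧ (N * t).cycleType = L}

open Classical in
/-- The matchings of `interpolants s t D L` that share no edge with both `s` and `t`. -/
noncomputable def fullInterpolants (s t : Perm α) (D L : Multiset ℕ) : Finset (Perm α) :=
  {N ∈ interpolants s t D L | ∀ x, N x = s x → N x ≠ t x}

theorem mem_interpolants {s t : Perm α} {D L : Multiset ℕ} {N : Perm α} :
    N ∈ interpolants s t D L ↔
      IsMatching N ∧ (s * N).cycleType = D ∧ (N * t).cycleType = L := by
  simp [interpolants]

theorem mem_fullInterpolants {s t : Perm α} {D L : Multiset ℕ} {N : Perm α} :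
    N ∈ fullInterpolants s t D L ↔
      N ∈ interpolants s t D L ∧ ∀ x, N x = s x → N x ≠ t x := by
  simp [fullInterpolants]

theorem permCongr_symm_permCongr {α β : Type*} (e : α ≃ β) (s : Perm α) :
    e.symm.permCongr (e.permCongr s) = s := by
  ext; simp

theorem permCongr_mem_interpolants (e : α ≃ β) {s t : Perm α} {D L : Multiset ℕ} {N : Perm α}
    (h : N ∈ interpolants s t D L) :
    e.permCongr N ∈ interpolants (e.permCongr s) (e.permCongr t) D L := by
  rw [mem_interpolants] at h ⊢
  rw [← permCongr_mul, ← permCongr_mul, cycleType_permCongr, cycleType_permCongr]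
  exact ⟨h.1.permCongr e, h.2⟩

theorem permCongr_mem_fullInterpolants (e : α ≃ β) {s t : Perm α} {D L : Multiset ℕ} {N : Perm α}
    (h : N ∈ fullInterpolants s t D L) :
    e.permCongr N ∈ fullInterpolants (e.permCongr s) (e.permCongr t) D L := by
  rw [mem_fullInterpolants] at h ⊢
  refine ⟨permCongr_mem_interpolants e h.1, fun x => ?_⟩
  simp only [permCongr_apply, ne_eq, EmbeddingLike.apply_eq_iff_eq]
  exact h.2 _

theorem card_interpolants_permCongr (e : α ≃ β) (s t : Perm α) (D L : Multiset ℕ) :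
    #(interpolants (e.permCongr s) (e.permCongr t) D L) = #(interpolants s t D L) := by
  symm
  refine card_nbij' e.permCongr e.symm.permCongr
    (fun N hN => permCongr_mem_interpolants e hN) (fun N hN => ?_) (fun N _ => ?_) (fun N _ => ?_)
  · have h := permCongr_mem_interpolants e.symm (mem_coe.1 hN)
    rwa [permCongr_symm_permCongr, permCongr_symm_permCongr] at h
  · ext; simp
  · ext; simp

theorem card_fullInterpolants_permCongr (e : α ≃ β) (s t : Perm α) (D L : Multiset ℕ) :
    #(fullInterpolants (e.permCongr s) (e.permCongr t) D L) = #(fullInterpolants s t D L) := by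
  symm
  refine card_nbij' e.permCongr e.symm.permCongr
    (fun N hN => permCongr_mem_fullInterpolants e hN) (fun N hN => ?_) (fun N _ => ?_)
    (fun N _ => ?_)
  · have h := permCongr_mem_fullInterpolants e.symm (mem_coe.1 hN)
    rwa [permCongr_symm_permCongr, permCongr_symm_permCongr] at h
  · ext; simp
  · ext; simp

/-- Off a set `p` that `s` and `t` preserve, the matchings in question have to agree with `s` and
`t`, so that only their restriction to `p` has to be counted. -/
theorem card_filter_interpolants {s t : Perm α} (hs : IsMatching s) (D L : Multiset ℕ)
    (p : α → Prop) [DecidablePred p] (hps : ∀ x, p (s x) ↔ p x) (hpt : ∀ x, p (t x) ↔ p x)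
    (hst : ∀ x, ¬ p x → s x = t x) :
    #{N ∈ interpolants s t D L | ∀ x, p x ↔ ¬ (N x = s x ∧ N x = t x)} =
      #(fullInterpolants (s.subtypePerm hps) (t.subtypePerm hpt) D L) := by
  classical
  set s' := s.subtypePerm hps with hs'
  set t' := t.subtypePerm hpt
  -- extend a matching of `p` by the common edges of `s` and `t`
  let ext' : Perm {x // p x} → Perm α := fun N' => s * ofSubtype (s' * N')
  have hmem : ∀ N' x (hx : p x), ext' N' x = N' ⟨x, hx⟩ := by
    intro N' x hx
    simp only [ext', Perm.mul_apply]
    rw [ofSubtype_apply_of_mem _ hx]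
    simp [hs', hs.1]
  have hnot : ∀ N' x, ¬ p x → ext' N' x = s x := by
    intro N' x hx
    simp only [ext', Perm.mul_apply]
    rw [ofSubtype_apply_of_not_mem _ hx]
  have hs1 : ∀ N', s * ext' N' = ofSubtype (s' * N') := by
    intro N'
    simp only [ext']
    rw [← mul_assoc, hs.mul_self, one_mul]
  have ht1 : ∀ N', ext' N' * t = ofSubtype (N' * t') := by
    intro N'
    ext x
    by_cases hx : p x
    · rw [Perm.mul_apply, hmem _ _ ((hpt x).2 hx), ofSubtype_apply_of_mem _ hx]
      rfl
    · rw [Perm.mul_apply, hnot _ _ (fun h => hx ((hpt x).1 h)), ofSubtype_apply_of_not_mem _ hx,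
        ← hst x hx, hs.1]
  have hpres : ∀ N ∈ interpolants s t D L, (∀ x, p x ↔ ¬ (N x = s x ∧ N x = t x)) →
      ∀ x, p (N x) ↔ p x := by
    intro N hN h
    have hN1 := (mem_interpolants.1 hN).1
    have key : ∀ x, ¬ p x → ¬ p (N x) := by
      intro x hx
      have hx' := not_not.1 (mt (h x).2 hx)
      rw [hx'.1, hps]
      exact hx
    exact fun x => ⟨fun hx => by_contra fun hx' => key x hx' hx,
      fun hx => by_contra fun hx' => key _ hx' (by rwa [hN1.1])⟩
  have hextsub : ∀ N ∈ interpolants s t D L, (h : ∀ x, p x ↔ ¬ (N x = s x ∧ N x = t x)) →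
      ∀ h' : ∀ x, p (N x) ↔ p x, ext' (N.subtypePerm h') = N := by
    intro N hN h h'
    ext x
    by_cases hx : p x
    · rw [hmem _ _ hx]; rfl
    · rw [hnot _ _ hx]
      exact (not_not.1 (mt (h x).2 hx)).1.symm
  symm
  refine card_bij (fun N' _ => ext' N') ?_ ?_ ?_
  · intro N' hN'
    rw [mem_fullInterpolants, mem_interpolants] at hN'
    obtain ⟨⟨hN, hD, hL⟩, hfull⟩ := hN'
    rw [mem_filter, mem_interpolants, hs1, ht1, cycleType_ofSubtype, cycleType_ofSubtype]
    refine ⟨⟨⟨fun x => ?_, fun x => ?_⟩, hD, hL⟩, fun x => ?_⟩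
    · by_cases hx : p x
      · rw [hmem _ _ hx, hmem _ _ (N' ⟨x, hx⟩).2, hN.1]
      · rw [hnot _ _ hx, hnot _ _ (fun h => hx ((hps x).1 h)), hs.1]
    · by_cases hx : p x
      · rw [hmem _ _ hx]
        exact fun h => hN.2 _ (Subtype.ext h)
      · rw [hnot _ _ hx]
        exact hs.2 x
    · constructor
      · rintro hx ⟨h1, h2⟩
        rw [hmem _ _ hx] at h1 h2
        exact hfull ⟨x, hx⟩ (Subtype.ext h1) (Subtype.ext h2)
      · intro h
        by_contra hx
        rw [hnot _ _ hx] at h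
        exact h ⟨rfl, hst x hx⟩
  · intro N₁ _ N₂ _ h
    ext x
    have := congrArg (fun f : Perm α => f x) h
    rwa [hmem _ _ x.2, hmem _ _ x.2] at this
  · intro N hN
    rw [mem_filter] at hN
    have h' := hpres N hN.1 hN.2
    have he := hextsub N hN.1 hN.2 h'
    refine ⟨N.subtypePerm h', ?_, he⟩
    have hN1 := mem_interpolants.1 hN.1
    rw [mem_fullInterpolants, mem_interpolants]
    refine ⟨⟨⟨fun x => Subtype.ext (hN1.1.1 x), fun x h => hN1.1.2 x (congrArg Subtype.val h)⟩,
      ?_, ?_⟩, fun x h1 h2 => (hN.2 x).1 x.2 ⟨congrArg Subtype.val h1, congrArg Subtype.val h2⟩⟩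
    · rw [← hN1.2.1, ← cycleType_ofSubtype, ← hs1, he]
    · rw [← hN1.2.2, ← cycleType_ofSubtype, ← ht1, he]

/-- Both degree bounds, as bounds for the number of points of a configuration in which no edge is
common to the three matchings: such a configuration has every point moved by `s * N` or `N * t`. -/
theorem card_le_of_mem_fullInterpolants {s t N : Perm α} (hs : IsMatching s)
    {D L : Multiset ℕ} (hN : N ∈ fullInterpolants s t D L) :
    Fintype.card α ≤ D.sum + L.sum ∧
    Fintype.card α + D.card + L.card ≤ D.sum + L.sum + (s * t).cycleType.card := by
  rw [mem_fullInterpolants, mem_interpolants] at hN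
  obtain ⟨⟨hM, hD, hL⟩, hfull⟩ := hN
  have hprod : s * N * (N * t) = s * t := by
    rw [mul_assoc, ← mul_assoc N N t, hM.mul_self, one_mul]
  have hmove : ∀ x, (s * N) x = x → (N * t) x ≠ x := by
    intro x h1 h2
    have h1' : N x = s x := by rw [← hs.1 (N x)]; exact congrArg s h1
    have h2' : N x = t x := by rw [← hM.1 (t x)]; exact (congrArg N h2).symm
    exact hfull x h1' h2'
  have h := card_add_card_cycleType_le (s * N) (N * t) hmove
  rw [hprod, ← sum_cycleType, ← sum_cycleType, hD, hL] at h
  refine ⟨?_, by omega⟩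
  have hu : (s * N).support ∪ (N * t).support = univ := by
    ext x
    simp only [mem_union, mem_support, mem_univ, iff_true]
    exact or_iff_not_imp_left.2 fun hx => hmove x (not_not.1 hx)
  rw [← hD, ← hL, sum_cycleType, sum_cycleType, ← card_univ, ← hu]
  exact card_union_le _ _

/-- The number of configurations without common edges on `m` edges, for a pair `s`, `t` whose type
has the nontrivial parts `R`. -/
noncomputable def fullCount (D L R : Multiset ℕ) (m : ℕ) : ℕ :=
  open Classical in
  if h : ∃ π : Perm (Fin m), π.cycleType = R then
    #(fullInterpolants (baseMatching (Fin m)) (twistedMatching h.choose) D L) else 0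

theorem card_fullInterpolants_eq_fullCount {s t : Perm α} (hs : IsMatching s) (ht : IsMatching t)
    (D L : Multiset ℕ) {R : Multiset ℕ} (hR : (s * t).cycleType = R + R) {m : ℕ}
    (hm : Fintype.card α = 2 * m) : #(fullInterpolants s t D L) = fullCount D L R m := by
  have hex : ∃ π : Perm (Fin m), π.cycleType = R := by
    obtain ⟨π, -, -, -, hπ⟩ := hs.exists_normal_form_of_cycleType ht hm hR
    exact ⟨π, hπ⟩
  rw [fullCount, dif_pos hex]
  obtain ⟨e, he1, he2⟩ := hs.exists_equiv ht isMatching_baseMatching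
    (isMatching_twistedMatching hex.choose) (by rw [hm]; simp [two_mul])
    (by rw [cycleType_baseMatching_mul_twistedMatching, hex.choose_spec, hR])
  rw [← he1, ← he2, card_fullInterpolants_permCongr]

theorem le_of_fullCount_ne_zero {D L R : Multiset ℕ} {m : ℕ} (h : fullCount D L R m ≠ 0) :
    2 * m ≤ D.sum + L.sum ∧ 2 * m + D.card + L.card ≤ D.sum + L.sum + 2 * R.card := by
  rw [fullCount] at h
  split_ifs at h with hex
  · obtain ⟨N, hN⟩ := card_pos.1 (Nat.pos_of_ne_zero h)
    have := card_le_of_mem_fullInterpolants isMatching_baseMatching hN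
    rw [cycleType_baseMatching_mul_twistedMatching, hex.choose_spec] at this
    simp only [Fintype.card_sum, Fintype.card_fin, Multiset.card_add] at this
    omega
  · exact absurd rfl h

theorem card_fiber_interpolants {ι : Type*} [Fintype ι] [DecidableEq ι] (π : Perm ι)
    (D L : Multiset ℕ) {U : Finset ι} (hU : π.support ⊆ U) :
    #{N ∈ interpolants (baseMatching ι) (twistedMatching π) D L |
      ∀ x, Sum.elim id id x ∈ U ↔ ¬ (N x = baseMatching ι x ∧ N x = twistedMatching π x)} =
      fullCount D L π.cycleType #U := by
  have hfix : ∀ i, i ∉ U → π i = i := fun i hi => notMem_support.1 fun h => hi (hU h)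
  have hfix' : ∀ i, i ∉ U → π⁻¹ i = i := fun i hi => by
    rw [inv_eq_iff_eq, hfix i hi]
  have hπU : ∀ i, π i ∈ U ↔ i ∈ U := by
    intro i
    by_cases h : π i = i
    · rw [h]
    · exact iff_of_true (hU (apply_mem_support.2 (mem_support.2 h))) (hU (mem_support.2 h))
  have hπU' : ∀ i, π⁻¹ i ∈ U ↔ i ∈ U := fun i => by
    rw [← hπU (π⁻¹ i), coe_inv, apply_symm_apply]
  have hps : ∀ x, Sum.elim id id (baseMatching ι x) ∈ U ↔ Sum.elim id id x ∈ U := by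
    rintro (i | i) <;> rfl
  have hpt : ∀ x, Sum.elim id id (twistedMatching π x) ∈ U ↔ Sum.elim id id x ∈ U := by
    rintro (i | i)
    · exact hπU i
    · exact hπU' i
  have hst : ∀ x, Sum.elim id id x ∉ U → baseMatching ι x = twistedMatching π x := by
    rintro (i | i) hi
    · rw [baseMatching_inl, twistedMatching_inl, hfix i hi]
    · rw [baseMatching_inr, twistedMatching_inr, hfix' i hi]
  rw [card_filter_interpolants isMatching_baseMatching D L (fun x => Sum.elim id id x ∈ U)
    hps hpt hst]
  have hs := isMatching_baseMatching (ι := ι)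
  have ht := isMatching_twistedMatching π
  refine card_fullInterpolants_eq_fullCount
    ⟨fun x => Subtype.ext (hs.1 x), fun x h => hs.2 x (congrArg Subtype.val h)⟩
    ⟨fun x => Subtype.ext (ht.1 x), fun x h => ht.2 x (congrArg Subtype.val h)⟩ D L ?_ ?_
  · have hpst : ∀ x, Sum.elim id id ((baseMatching ι * twistedMatching π) x) ∈ U ↔
        Sum.elim id id x ∈ U := fun x => (hps _).trans (hpt x)
    have hmoved : ∀ x, (baseMatching ι * twistedMatching π) x ≠ x → Sum.elim id id x ∈ U := by
      intro x hx
      by_contra hxU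
      exact hx (by rw [Perm.mul_apply, ← hst x hxU, hs.1])
    rw [← cycleType_baseMatching_mul_twistedMatching, ← ofSubtype_subtypePerm hpst hmoved,
      cycleType_ofSubtype]
    rfl
  · have e : {x : ι ⊕ ι // Sum.elim id id x ∈ U} ≃ U ⊕ U := Equiv.subtypeSum
    rw [Fintype.card_congr e]
    simp [two_mul]

/-- Every configuration is obtained from one without common edges by adding common edges, which
are chosen among the edges shared by `s` and `t`. -/
theorem card_interpolants_eq_sum {s t : Perm α} (hs : IsMatching s) (ht : IsMatching t)
    (D L : Multiset ℕ) {R : Multiset ℕ} (hR : (s * t).cycleType = R + R) {n : ℕ}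
    (hn : Fintype.card α = 2 * n) :
    #(interpolants s t D L) =
      ∑ j ∈ range (n - R.sum + 1), (n - R.sum).choose j * fullCount D L R (R.sum + j) := by
  obtain ⟨π, e, hes, het, hπ⟩ := hs.exists_normal_form_of_cycleType ht hn hR
  rw [← card_interpolants_permCongr e, hes, het]
  -- the edges of `s` that are not shared by all three matchings
  let φ : Perm (Fin n ⊕ Fin n) → Finset (Fin n) := fun N =>
    {i | ¬ (N (.inl i) = baseMatching _ (.inl i) ∧ N (.inl i) = twistedMatching π (.inl i))}
  have hφ : ∀ N ∈ interpolants (baseMatching (Fin n)) (twistedMatching π) D L, ∀ U,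
      φ N = U ↔ ∀ x, Sum.elim id id x ∈ U ↔
        ¬ (N x = baseMatching _ x ∧ N x = twistedMatching π x) := by
    intro N hN U
    have hM := (mem_interpolants.1 hN).1
    have hflip : ∀ i, (N (.inl i) = baseMatching _ (.inl i) ∧
        N (.inl i) = twistedMatching π (.inl i)) ↔
        (N (.inr i) = baseMatching _ (.inr i) ∧ N (.inr i) = twistedMatching π (.inr i)) := by
      intro i
      simp only [baseMatching_inl, baseMatching_inr, twistedMatching_inl, twistedMatching_inr]
      constructor
      · rintro ⟨h1, h2⟩
        have h3 : π i = i := (Sum.inr_injective (h1.symm.trans h2)).symm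
        have h4 : π⁻¹ i = i := by rw [inv_eq_iff_eq, h3]
        have h5 : N (.inr i) = .inl i := by rw [← h1, hM.1]
        exact ⟨h5, by rw [h5, h4]⟩
      · rintro ⟨h1, h2⟩
        have h4 : π⁻¹ i = i := (Sum.inl_injective (h1.symm.trans h2)).symm
        have h3 : π i = i := by rw [inv_eq_iff_eq] at h4; exact h4.symm
        have h5 : N (.inl i) = .inr i := by rw [← h1, hM.1]
        exact ⟨h5, by rw [h5, h3]⟩
    constructor
    · rintro rfl (i | i)
      · simp [φ]
      · simp only [Sum.elim_inr, id, φ, mem_filter, mem_univ, true_and]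
        rw [hflip]
    · intro h
      ext i
      simp only [φ, mem_filter, mem_univ, true_and]
      exact (h (.inl i)).symm
  have hsupp : ∀ N ∈ interpolants (baseMatching (Fin n)) (twistedMatching π) D L,
      φ N ∈ Icc π.support univ := by
    intro N _
    rw [mem_Icc]
    refine ⟨fun i hi => ?_, subset_univ _⟩
    refine mem_filter.2 ⟨mem_univ _, ?_⟩
    rintro ⟨h1, h2⟩
    exact mem_support.1 hi (Sum.inr_injective (h1.symm.trans h2)).symm
  rw [card_eq_sum_card_fiberwise (fun N hN => hsupp N hN)]
  have h1 : ∀ U ∈ Icc π.support univ,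
      #{N ∈ interpolants (baseMatching (Fin n)) (twistedMatching π) D L | φ N = U} =
        fullCount D L R #U := by
    intro U hU
    rw [← hπ, ← card_fiber_interpolants π D L (mem_Icc.1 hU).1]
    congr 1
    exact filter_congr fun N hN => hφ N hN U
  have hsum : #π.support = R.sum := by rw [← sum_cycleType, hπ]
  rw [sum_congr rfl h1, Icc_eq_image_powerset (subset_univ _), sum_image]
  · have h2 : ∀ V ∈ (univ \ π.support).powerset, fullCount D L R #(π.support ∪ V) =
        fullCount D L R (R.sum + #V) := by
      intro V hV
      rw [card_union_of_disjoint, hsum]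
      exact disjoint_of_subset_right (mem_powerset.1 hV) disjoint_sdiff
    rw [sum_congr rfl h2, sum_powerset_apply_card (fun j => fullCount D L R (R.sum + j)),
      card_sdiff_of_subset (subset_univ _), card_univ, Fintype.card_fin, hsum]
    simp only [smul_eq_mul]
  · intro V hV W hW h
    have hV' : Disjoint π.support V :=
      disjoint_of_subset_right (mem_powerset.1 hV) disjoint_sdiff
    have hW' : Disjoint π.support W :=
      disjoint_of_subset_right (mem_powerset.1 hW) disjoint_sdiff
    rw [← union_sdiff_cancel_left hV', ← union_sdiff_cancel_left hW']
    exact congrArg (· \ π.support) h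

end Counting

/-! ### Coset-types and cycle types -/

section CosetType

/-- The matching of `2n` points with the edges `{2k, 2k+1}`. -/
def stdMatching (n : ℕ) : Perm (Fin (2 * n)) where
  toFun i := ⟨if (i : ℕ) % 2 = 0 then i + 1 else i - 1, by split_ifs <;> omega⟩
  invFun i := ⟨if (i : ℕ) % 2 = 0 then i + 1 else i - 1, by split_ifs <;> omega⟩
  left_inv i := by
    ext
    simp only
    split_ifs <;> omega
  right_inv i := by
    ext
    simp only
    split_ifs <;> omega

theorem stdMatching_val {n : ℕ} (i : Fin (2 * n)) :
    (stdMatching n i : ℕ) = if (i : ℕ) % 2 = 0 then (i : ℕ) + 1 else i - 1 := rfl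

theorem isMatching_stdMatching (n : ℕ) : IsMatching (stdMatching n) :=
  ⟨fun i => (stdMatching n).left_inv i, fun i h => by
    have := congrArg Fin.val h
    rw [stdMatching_val] at this
    split_ifs at this <;> omega⟩

theorem div_two_eq_iff {n : ℕ} (i j : Fin (2 * n)) :
    (i : ℕ) / 2 = (j : ℕ) / 2 ↔ j = i ∨ j = stdMatching n i := by
  rw [Fin.ext_iff, Fin.ext_iff, stdMatching_val]
  split_ifs <;> omega

/-- The second matching of the graph `Γ(w)`, which joins `i` and `j` when `w i` and `w j` form a
pair. -/
def imageMatching {n : ℕ} (w : Perm (Fin (2 * n))) : Perm (Fin (2 * n)) :=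
  w⁻¹ * stdMatching n * w

theorem isMatching_imageMatching {n : ℕ} (w : Perm (Fin (2 * n))) :
    IsMatching (imageMatching w) := by
  have := (isMatching_stdMatching n).conj w⁻¹
  rwa [inv_inv] at this

/-- The graph `Γ(w)` is the union of the two matchings. -/
theorem cosetGraph_adj {n : ℕ} (w : Perm (Fin (2 * n))) (i j : Fin (2 * n)) :
    (cosetGraph w).Adj i j ↔ j = stdMatching n i ∨ j = imageMatching w i := by
  have h1 : w j = stdMatching n (w i) ↔ j = imageMatching w i := by
    rw [imageMatching, Perm.mul_apply, Perm.mul_apply, eq_comm, eq_comm (a := j), inv_eq_iff_eq]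
  have h2 : (i : ℕ) / 2 = (j : ℕ) / 2 ∨ (w i : ℕ) / 2 = (w j : ℕ) / 2 ↔
      j = i ∨ j = stdMatching n i ∨ j = imageMatching w i := by
    rw [div_two_eq_iff, div_two_eq_iff, h1, EmbeddingLike.apply_eq_iff_eq]
    tauto
  rw [cosetGraph, SimpleGraph.fromRel_adj, eq_comm (a := (j : ℕ) / 2),
    eq_comm (a := (w j : ℕ) / 2), or_self, h2]
  constructor
  · rintro ⟨h, h' | h'⟩
    · exact absurd h'.symm h
    · exact h'
  · intro h
    refine ⟨?_, Or.inr h⟩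
    rintro rfl
    rcases h with h | h
    · exact (isMatching_stdMatching n).2 _ h.symm
    · exact (isMatching_imageMatching w).2 _ h.symm

/-- In the normal form, the components of `Γ(w)` are the orbits of `π`. -/
theorem cosetGraph_reachable_iff {n : ℕ} (w : Perm (Fin (2 * n))) (π : Perm (Fin n))
    (e : Fin (2 * n) ≃ Fin n ⊕ Fin n) (hs : e.permCongr (stdMatching n) = baseMatching _)
    (ht : e.permCongr (imageMatching w) = twistedMatching π) (x y : Fin (2 * n)) :
    (cosetGraph w).Reachable x y ↔
      SameCycle π (Sum.elim id id (e x)) (Sum.elim id id (e y)) := by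
  have hs' : ∀ x, e (stdMatching n x) = baseMatching _ (e x) := fun x => by rw [← hs]; simp
  have ht' : ∀ x, e (imageMatching w x) = twistedMatching π (e x) := fun x => by rw [← ht]; simp
  constructor
  · rintro ⟨p⟩
    induction p with
    | nil => exact SameCycle.refl _ _
    | cons h _ ih =>
      refine SameCycle.trans ?_ ih
      rcases (cosetGraph_adj w _ _).1 h with rfl | rfl
      · rw [hs']
        generalize e _ = z
        rcases z with i | i <;> exact SameCycle.refl _ _
      · rw [ht']
        generalize e _ = z
        rcases z with i | i
        · exact sameCycle_apply_right.2 (SameCycle.refl _ _)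
        · exact sameCycle_symm_apply_right.2 (SameCycle.refl _ _)
  · have hadj_s : ∀ i, (cosetGraph w).Reachable (e.symm (.inl i)) (e.symm (.inr i)) := by
      intro i
      refine SimpleGraph.Adj.reachable ((cosetGraph_adj w _ _).2 (Or.inl ?_))
      rw [symm_apply_eq, hs', apply_symm_apply, baseMatching_inl]
    have hadj_t : ∀ i, (cosetGraph w).Reachable (e.symm (.inl i)) (e.symm (.inr (π i))) := by
      intro i
      refine SimpleGraph.Adj.reachable ((cosetGraph_adj w _ _).2 (Or.inr ?_))
      rw [symm_apply_eq, ht', apply_symm_apply, twistedMatching_inl]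
    have hstep : ∀ i, (cosetGraph w).Reachable (e.symm (.inl i)) (e.symm (.inl (π i))) :=
      fun i => (hadj_t i).trans (hadj_s _).symm
    have hpow : ∀ i j, SameCycle π i j →
        (cosetGraph w).Reachable (e.symm (.inl i)) (e.symm (.inl j)) := by
      intro i j hij
      obtain ⟨k, -, -, rfl⟩ := hij.exists_pow_eq
      clear hij
      induction k with
      | zero => exact SimpleGraph.Reachable.refl _
      | succ k ih => rw [pow_succ', Perm.mul_apply]; exact ih.trans (hstep _)
    have hall : ∀ x, (cosetGraph w).Reachable x (e.symm (.inl (Sum.elim id id (e x)))) := by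
      intro x
      obtain ⟨z, rfl⟩ := e.symm.surjective x
      rw [apply_symm_apply]
      rcases z with i | i
      · exact SimpleGraph.Reachable.refl _
      · exact (hadj_s i).symm
    intro h
    exact ((hall x).trans (hpow _ _ h)).trans (hall y).symm

open Classical in
theorem cosetType_eq_of_normal_form {n : ℕ} (w : Perm (Fin (2 * n))) (π : Perm (Fin n))
    (e : Fin (2 * n) ≃ Fin n ⊕ Fin n) (hs : e.permCongr (stdMatching n) = baseMatching _)
    (ht : e.permCongr (imageMatching w) = twistedMatching π) :
    cosetType w = π.cycleType + Multiset.replicate (n - π.cycleType.sum) 1 := by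
  have hreach := cosetGraph_reachable_iff w π e hs ht
  let q : Fin (2 * n) → Quotient (SameCycle.setoid π) := fun x => ⟦Sum.elim id id (e x)⟧
  have hq : ∀ x y, (cosetGraph w).Reachable x y ↔ q x = q y := fun x y => by
    rw [hreach]; exact (Quotient.eq (r := SameCycle.setoid π)).symm
  let F : (cosetGraph w).ConnectedComponent → Quotient (SameCycle.setoid π) :=
    SimpleGraph.ConnectedComponent.lift q fun x y p _ => (hq x y).1 ⟨p⟩
  have hF : ∀ x, F ((cosetGraph w).connectedComponentMk x) = q x := fun x => rfl
  have hFbij : Function.Bijective F := by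
    constructor
    · intro C C'
      induction C using SimpleGraph.ConnectedComponent.ind with | _ x
      induction C' using SimpleGraph.ConnectedComponent.ind with | _ y
      rw [hF, hF, ← hq]
      exact fun h => SimpleGraph.ConnectedComponent.sound h
    · intro k
      obtain ⟨i, rfl⟩ := Quotient.exists_rep k
      refine ⟨(cosetGraph w).connectedComponentMk (e.symm (.inl i)), ?_⟩
      rw [hF]
      simp [q]
  have hsize : ∀ C : (cosetGraph w).ConnectedComponent, C.supp.ncard / 2 =
      #{i | (⟦i⟧ : Quotient (SameCycle.setoid π)) = F C} := by
    intro C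
    have h1 : C.supp = e ⁻¹' ((Finset.disjSum
        ({i | (⟦i⟧ : Quotient (SameCycle.setoid π)) = F C} : Finset (Fin n))
        ({i | (⟦i⟧ : Quotient (SameCycle.setoid π)) = F C} : Finset (Fin n)) :
          Finset (Fin n ⊕ Fin n)) : Set (Fin n ⊕ Fin n)) := by
      ext x
      rw [SimpleGraph.ConnectedComponent.mem_supp_iff, ← hFbij.1.eq_iff, hF]
      simp only [q, Set.mem_preimage, mem_coe]
      generalize e x = z
      rcases z with i | i <;> simp
    rw [h1, Set.ncard_preimage_of_injective_subset_range e.injective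
      (by rw [e.surjective.range_eq]; exact Set.subset_univ _), Set.ncard_coe_finset, card_disjSum]
    omega
  have h := map_orbit_card π
  rw [parts_partition, Fintype.card_fin, ← sum_cycleType] at h
  rw [← h, cosetType, Multiset.map_congr rfl fun C _ => hsize C,
    ← Multiset.map_univ_val_equiv (Equiv.ofBijective F hFbij), Multiset.map_map]
  rfl

theorem exists_normal_form_stdMatching {n : ℕ} (w : Perm (Fin (2 * n))) :
    ∃ π : Perm (Fin n), cosetType w = π.cycleType + Multiset.replicate (n - π.cycleType.sum) 1 ∧
      (stdMatching n * imageMatching w).cycleType = π.cycleType + π.cycleType := by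
  obtain ⟨π, e, hs, ht⟩ := (isMatching_stdMatching n).exists_normal_form
    (isMatching_imageMatching w) (Fintype.card_fin _)
  refine ⟨π, cosetType_eq_of_normal_form w π e hs ht, ?_⟩
  rw [← cycleType_permCongr e, permCongr_mul, hs, ht, cycleType_baseMatching_mul_twistedMatching]

theorem filter_ne_one_of_add_replicate {R : Multiset ℕ} (hR : 1 ∉ R) (k : ℕ) :
    (R + Multiset.replicate k 1).filter (· ≠ 1) = R := by
  have h1 : R.filter (· ≠ 1) = R := Multiset.filter_eq_self.2 fun x hx h => hR (h ▸ hx)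
  have h2 : (Multiset.replicate k 1).filter (· ≠ 1) = 0 :=
    Multiset.filter_eq_nil.2 fun x hx h => h (Multiset.eq_of_mem_replicate hx)
  rw [Multiset.filter_add, h1, h2, add_zero]

theorem one_notMem_cycleType {α : Type*} [Fintype α] [DecidableEq α] (π : Perm α) :
    1 ∉ π.cycleType := fun h => by have := two_le_of_mem_cycleType h; omega

/-- The coset-type of `w` is read off from the product of the two matchings of `Γ(w)`: a cycle of
length `2k` of the graph gives two cycles of length `k` of the product. -/
theorem cosetType_eq_complete_iff {n a : ℕ} (w : Perm (Fin (2 * n))) (lam : a.Partition)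
    (hlam : IsProper lam) (ha : a ≤ n) : cosetType w = (complete lam ha).parts ↔
      (stdMatching n * imageMatching w).cycleType = lam.parts + lam.parts := by
  obtain ⟨π, h1, h2⟩ := exists_normal_form_stdMatching w
  rw [h1, h2]
  constructor
  · intro h
    have := congrArg (Multiset.filter (· ≠ 1)) h
    rw [complete, filter_ne_one_of_add_replicate (one_notMem_cycleType π),
      filter_ne_one_of_add_replicate hlam] at this
    rw [this]
  · intro h
    rw [eq_of_add_self_eq h, lam.parts_sum]
    rfl

theorem cycleType_eq_of_cosetType_eq {n : ℕ} {w w' : Perm (Fin (2 * n))}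
    (h : cosetType w = cosetType w') : (stdMatching n * imageMatching w).cycleType =
      (stdMatching n * imageMatching w').cycleType := by
  obtain ⟨π, h1, h2⟩ := exists_normal_form_stdMatching w
  obtain ⟨π', h1', h2'⟩ := exists_normal_form_stdMatching w'
  rw [h1, h1'] at h
  have := congrArg (Multiset.filter (· ≠ 1)) h
  rw [filter_ne_one_of_add_replicate (one_notMem_cycleType π),
    filter_ne_one_of_add_replicate (one_notMem_cycleType π')] at this
  rw [h2, h2', this]

theorem IsMatching.isConj {α : Type*} [Finite α] {s t : Perm α} (hs : IsMatching s)
    (ht : IsMatching t) : IsConj s t := by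
  classical
  have := Fintype.ofFinite α
  obtain ⟨e, he, -⟩ := hs.exists_equiv hs ht ht rfl (by rw [hs.mul_self, ht.mul_self])
  exact isConj_iff.2 ⟨e, by rw [← he]; ext; simp⟩

theorem exists_partition_of_cosetType {n : ℕ} (w : Perm (Fin (2 * n))) :
    ∃ τ : n.Partition, cosetType w = τ.parts := by
  obtain ⟨π, h1, -⟩ := exists_normal_form_stdMatching w
  have hle := π.sum_cycleType_le
  rw [Fintype.card_fin] at hle
  refine ⟨⟨cosetType w, ?_, ?_⟩, rfl⟩
  · intro i hi
    rw [h1, Multiset.mem_add] at hi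
    rcases hi with hi | hi
    · have := two_le_of_mem_cycleType hi; omega
    · rw [Multiset.eq_of_mem_replicate hi]; exact Nat.one_pos
  · rw [h1, Multiset.sum_add, Multiset.sum_replicate, smul_eq_mul, mul_one]
    omega

/-- Every partition of `n` is a coset-type, so that no class sum vanishes. -/
theorem exists_cosetType_eq {n : ℕ} (τ : n.Partition) :
    ∃ w : Perm (Fin (2 * n)), cosetType w = τ.parts := by
  have hsplit := Multiset.filter_add_not (2 ≤ ·) τ.parts
  have hone : τ.parts.filter (¬ 2 ≤ ·) =
      Multiset.replicate (τ.parts.filter (¬ 2 ≤ ·)).card 1 := by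
    rw [Multiset.eq_replicate_card]
    intro i hi
    have := τ.parts_pos (Multiset.mem_filter.1 hi).1
    have := (Multiset.mem_filter.1 hi).2
    omega
  have hsum := congrArg Multiset.sum hsplit
  rw [hone, Multiset.sum_add, Multiset.sum_replicate, smul_eq_mul, mul_one, τ.parts_sum] at hsum
  obtain ⟨π, hπ⟩ := (Equiv.Perm.exists_with_cycleType_iff (Fin n)
    (m := τ.parts.filter (2 ≤ ·))).2
    ⟨by rw [Fintype.card_fin]; omega, fun i hi => (Multiset.mem_filter.1 hi).2⟩
  obtain ⟨-, e, hs, -⟩ := (isMatching_stdMatching n).exists_normal_form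
    (isMatching_stdMatching n) (Fintype.card_fin _)
  obtain ⟨g, hg⟩ := isConj_iff.1 ((isMatching_stdMatching n).isConj
    ((isMatching_twistedMatching π).permCongr e.symm))
  refine ⟨g⁻¹, ?_⟩
  have hk : n - (τ.parts.filter (2 ≤ ·)).sum = (τ.parts.filter (¬ 2 ≤ ·)).card := by omega
  rw [cosetType_eq_of_normal_form g⁻¹ π e hs, hπ, hk, ← hone, hsplit]
  · rw [imageMatching, inv_inv, hg]
    ext; simp

end CosetType

/-! ### Products of class sums -/

section Coefficients

/-- The number of permutations that carry the standard matching to a given matching. -/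
theorem card_filter_imageMatching_eq {n : ℕ} {N : Perm (Fin (2 * n))} (hN : IsMatching N) :
    #{y : Perm (Fin (2 * n)) | imageMatching y = N} = 2 ^ n * n.factorial := by
  obtain ⟨g, hg⟩ := isConj_iff.1 ((isMatching_stdMatching n).isConj hN)
  have hct : (stdMatching n).cycleType = Multiset.replicate n 2 := by
    have h1 := (isMatching_stdMatching n).cycleType_eq_replicate_card
    have h2 := (isMatching_stdMatching n).card_eq
    rw [Fintype.card_fin] at h2
    rwa [← Nat.eq_of_mul_eq_mul_left two_pos h2] at h1
  have hcard : Nat.card (Subgroup.centralizer {stdMatching n}) = 2 ^ n * n.factorial := by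
    rw [nat_card_centralizer, hct]
    rcases Nat.eq_zero_or_pos n with rfl | hn
    · simp
    · simp [Multiset.toFinset_replicate, hn.ne', mul_comm]
  rw [← hcard, ← Fintype.card_subtype, ← Nat.card_eq_fintype_card]
  refine Nat.card_congr (Equiv.subtypeEquiv (Equiv.mulRight g) fun y => ?_)
  rw [Subgroup.mem_centralizer_singleton_iff, coe_mulRight, imageMatching, ← hg]
  constructor
  · intro h
    calc y * g * stdMatching n = y * (g * stdMatching n * g⁻¹) * g := by group
      _ = stdMatching n * (y * g) := by rw [← h]; group
  · intro h
    calc y⁻¹ * stdMatching n * y = y⁻¹ * (stdMatching n * (y * g)) * g⁻¹ := by group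
      _ = g * stdMatching n * g⁻¹ := by rw [← h]; group

theorem coeff_classSum {n : ℕ} (lam : n.Partition) (w : Perm (Fin (2 * n)))
    [Decidable (cosetType w = lam.parts)] :
    (classSum lam).coeff w = if cosetType w = lam.parts then 1 else 0 := by
  classical
  rw [classSum, MonoidAlgebra.coeff_sum, Finsupp.finsetSum_apply]
  simp [Finsupp.single_apply]

open Classical in
theorem coeff_classSum_mul_classSum {n : ℕ} (lam del : n.Partition) (w : Perm (Fin (2 * n))) :
    (classSum lam * classSum del).coeff w =
      #{y : Perm (Fin (2 * n)) | cosetType (w * y⁻¹) = lam.parts ∧ cosetType y = del.parts} := by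
  rw [classSum, classSum, sum_mul_sum, sum_comm, MonoidAlgebra.coeff_sum,
    Finsupp.finsetSum_apply, card_filter, sum_filter]
  push_cast
  refine sum_congr rfl fun y _ => ?_
  rw [MonoidAlgebra.coeff_sum, Finsupp.finsetSum_apply]
  simp only [MonoidAlgebra.of_apply, MonoidAlgebra.single_mul_single, MonoidAlgebra.coeff_single,
    Finsupp.single_apply, mul_one, ← eq_mul_inv_iff_mul_eq]
  rw [sum_ite_eq']
  simp [ite_and, and_comm]

/-- The coefficients of a product of two class sums count matchings that interpolate between the
two matchings of `Γ(w)`. -/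
theorem coeff_mul_eq_card_interpolants {n a b : ℕ} {lam : a.Partition} {del : b.Partition}
    (hlam : IsProper lam) (hdel : IsProper del) (ha : a ≤ n) (hb : b ≤ n)
    (w : Perm (Fin (2 * n))) :
    (classSum (complete lam ha) * classSum (complete del hb)).coeff w =
      2 ^ n * (n.factorial : ℂ) * #(interpolants (stdMatching n) (imageMatching w)
        (del.parts + del.parts) (lam.parts + lam.parts)) := by
  classical
  have hconj : ∀ y : Perm (Fin (2 * n)),
      (stdMatching n * imageMatching (w * y⁻¹)).cycleType =
        (imageMatching y * imageMatching w).cycleType := by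
    intro y
    rw [← cycleType_conj (τ := y⁻¹)]
    congr 1
    simp only [imageMatching]
    group
  have hmem : ∀ y : Perm (Fin (2 * n)),
      (cosetType (w * y⁻¹) = (complete lam ha).parts ∧ cosetType y = (complete del hb).parts) ↔
      imageMatching y ∈ interpolants (stdMatching n) (imageMatching w)
        (del.parts + del.parts) (lam.parts + lam.parts) := by
    intro y
    rw [cosetType_eq_complete_iff _ _ hlam, cosetType_eq_complete_iff _ _ hdel, hconj,
      mem_interpolants]
    have := isMatching_imageMatching y
    tauto
  rw [coeff_classSum_mul_classSum]
  simp only [hmem]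
  generalize hI : interpolants (stdMatching n) (imageMatching w) (del.parts + del.parts)
    (lam.parts + lam.parts) = I
  have hmaps : Set.MapsTo imageMatching
      (({y | imageMatching y ∈ I} : Finset (Perm (Fin (2 * n)))) : Set (Perm (Fin (2 * n)))) I :=
    fun y hy => (mem_filter.1 (mem_coe.1 hy)).2
  rw [card_eq_sum_card_fiberwise hmaps]
  have hfib : ∀ N ∈ I, #{y ∈ {y : Perm (Fin (2 * n)) | imageMatching y ∈ I} |
      imageMatching y = N} = 2 ^ n * n.factorial := by
    intro N hN
    have hM : IsMatching N := by
      rw [← hI, mem_interpolants] at hN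
      exact hN.1
    rw [← card_filter_imageMatching_eq hM, filter_filter]
    congr 1
    refine filter_congr fun y _ => ?_
    exact ⟨fun h => h.2, fun h => ⟨h ▸ hN, h⟩⟩
  rw [sum_congr rfl hfib, sum_const, smul_eq_mul]
  push_cast
  ring

/-- An element of the group algebra whose coefficients depend only on the coset-type is a
combination of the class sums in exactly one way. -/
theorem eq_sum_smul_classSum_iff {n : ℕ} (P : MonoidAlgebra ℂ (Perm (Fin (2 * n))))
    (hP : ∀ w w', cosetType w = cosetType w' → P.coeff w = P.coeff w')
    (r : n.Partition → Perm (Fin (2 * n))) (hr : ∀ τ, cosetType (r τ) = τ.parts)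
    (β : n.Partition → ℂ) :
    P = ∑ τ : n.Partition, β τ • classSum τ ↔ β = fun τ => P.coeff (r τ) := by
  classical
  have hcoeff : ∀ (τ : n.Partition) (w : Perm (Fin (2 * n))), cosetType w = τ.parts →
      (∑ τ : n.Partition, β τ • classSum τ).coeff w = β τ := by
    intro τ w hw
    rw [MonoidAlgebra.coeff_sum, Finsupp.finsetSum_apply, sum_eq_single τ]
    · rw [MonoidAlgebra.coeff_smul_apply, coeff_classSum, if_pos hw, smul_eq_mul, mul_one]
    · intro τ' _ hne
      rw [MonoidAlgebra.coeff_smul_apply, coeff_classSum, if_neg, smul_zero]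
      exact fun h => hne (Nat.Partition.ext (h.symm.trans hw))
    · exact fun h => absurd (mem_univ _) h
  constructor
  · intro h
    ext τ
    rw [← hcoeff τ (r τ) (hr τ), ← h]
  · intro h
    ext w
    obtain ⟨τ, hτ⟩ := exists_partition_of_cosetType w
    rw [hcoeff τ w hτ, h]
    exact hP _ _ (hτ.trans (hr τ).symm)

end Coefficients

/-! ### The structure polynomial -/

section Polynomiality

/-- The binomial coefficient `(x - c).choose j` as a polynomial in `x`. -/
noncomputable def shiftedBinomial (c j : ℕ) : ℚ[X] :=
  C ((j.factorial : ℚ)⁻¹) * (descPochhammer ℚ j).comp (X - C (c : ℚ))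

theorem shiftedBinomial_eval {c n : ℕ} (h : c ≤ n) (j : ℕ) :
    (shiftedBinomial c j).eval (n : ℚ) = ((n - c).choose j : ℚ) := by
  rw [shiftedBinomial, eval_mul, eval_C, eval_comp, eval_sub, eval_X, eval_C, ← Nat.cast_sub h,
    descPochhammer_eval_eq_descFactorial, Nat.descFactorial_eq_factorial_mul_choose, Nat.cast_mul,
    inv_mul_cancel_left₀ (Nat.cast_ne_zero.2 j.factorial_ne_zero)]

theorem natDegree_shiftedBinomial_le (c j : ℕ) : (shiftedBinomial c j).natDegree ≤ j := by
  refine (natDegree_C_mul_le _ _).trans (natDegree_comp_le.trans ?_)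
  rw [descPochhammer_natDegree, natDegree_X_sub_C, mul_one]

/-- The structure polynomial: the `j`-th term counts the configurations on `c + j` edges without
common edges, and the choices of those edges. The terms with `j > a + b` vanish. -/
noncomputable def structurePolynomial {a b c : ℕ} (lam : a.Partition) (del : b.Partition)
    (rho : c.Partition) : ℚ[X] :=
  ∑ j ∈ range (a + b + 1),
    C (fullCount (del.parts + del.parts) (lam.parts + lam.parts) rho.parts (c + j) : ℚ) *
      shiftedBinomial c j

variable {a b c : ℕ} {lam : a.Partition} {del : b.Partition} {rho : c.Partition}

theorem le_of_fullCount_partition_ne_zero {j : ℕ} (h : fullCount (del.parts + del.parts)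
    (lam.parts + lam.parts) rho.parts (c + j) ≠ 0) : c + j ≤ a + b ∧
      c + j + lam.parts.card + del.parts.card ≤ a + b + rho.parts.card := by
  have := le_of_fullCount_ne_zero h
  simp only [Multiset.sum_add, Multiset.card_add, lam.parts_sum, del.parts_sum] at this
  omega

theorem le_of_structurePolynomial_ne_zero (h : structurePolynomial lam del rho ≠ 0) :
    c + (structurePolynomial lam del rho).natDegree ≤ a + b ∧
      c + (structurePolynomial lam del rho).natDegree + lam.parts.card + del.parts.card ≤
        a + b + rho.parts.card := by
  by_contra hcon
  apply leadingCoeff_ne_zero.2 h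
  rw [leadingCoeff, structurePolynomial, finsetSum_coeff]
  refine sum_eq_zero fun j _ => ?_
  rw [← structurePolynomial, coeff_C_mul]
  by_cases hj : fullCount (del.parts + del.parts) (lam.parts + lam.parts) rho.parts (c + j) = 0
  · rw [hj, Nat.cast_zero, zero_mul]
  · have := le_of_fullCount_partition_ne_zero hj
    rw [coeff_eq_zero_of_natDegree_lt, mul_zero]
    refine (natDegree_shiftedBinomial_le c j).trans_lt ?_
    omega

theorem structurePolynomial_eval {n : ℕ} (hc : c ≤ n) :
    (structurePolynomial lam del rho).eval (n : ℚ) =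
      ((∑ j ∈ range (n - c + 1), (n - c).choose j *
        fullCount (del.parts + del.parts) (lam.parts + lam.parts) rho.parts (c + j) : ℕ) : ℚ) := by
  have h : ∀ j, eval (n : ℚ) (C (fullCount (del.parts + del.parts) (lam.parts + lam.parts)
      rho.parts (c + j) : ℚ) * shiftedBinomial c j) = (((n - c).choose j *
        fullCount (del.parts + del.parts) (lam.parts + lam.parts) rho.parts (c + j) : ℕ) : ℚ) := by
    intro j
    rw [eval_mul, eval_C, shiftedBinomial_eval hc, Nat.cast_mul, mul_comm]
  rw [structurePolynomial, eval_finsetSum, sum_congr rfl fun j _ => h j, ← Nat.cast_sum]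
  congr 1
  -- both sums consist of the same nonzero terms
  rw [sum_subset (range_subset_range.2 (Nat.le_add_right (a + b + 1) (n - c + 1))),
    sum_subset (range_subset_range.2 (Nat.le_add_left (n - c + 1) (a + b + 1)))]
  · intro j _ hj
    rw [mem_range, not_lt] at hj
    rw [Nat.choose_eq_zero_of_lt (by omega), zero_mul]
  · intro j _ hj
    rw [mem_range, not_lt] at hj
    by_contra hne
    have := le_of_fullCount_partition_ne_zero (right_ne_zero_of_mul hne)
    omega

theorem isStructurePolynomial_structurePolynomial (hlam : IsProper lam) (hdel : IsProper del)
    (hrho : IsProper rho) : IsStructurePolynomial lam del rho (structurePolynomial lam del rho) := by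
  intro n ha hb hc
  choose r hr using exists_cosetType_eq (n := n)
  have hP : ∀ w w' : Perm (Fin (2 * n)), cosetType w = cosetType w' →
      (classSum (complete lam ha) * classSum (complete del hb)).coeff w =
        (classSum (complete lam ha) * classSum (complete del hb)).coeff w' := by
    intro w w' h
    obtain ⟨e, hes, het⟩ := (isMatching_stdMatching n).exists_equiv (isMatching_imageMatching w)
      (isMatching_stdMatching n) (isMatching_imageMatching w') rfl (cycleType_eq_of_cosetType_eq h)
    rw [coeff_mul_eq_card_interpolants hlam hdel, coeff_mul_eq_card_interpolants hlam hdel,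
      ← card_interpolants_permCongr e (stdMatching n) (imageMatching w), hes, het]
  refine ⟨_, fun β => eq_sum_smul_classSum_iff _ hP r hr β, ?_⟩
  have hR := (cosetType_eq_complete_iff _ rho hrho hc).1 (hr (complete rho hc))
  rw [coeff_mul_eq_card_interpolants hlam hdel, structurePolynomial_eval hc,
    card_interpolants_eq_sum (isMatching_stdMatching n) (isMatching_imageMatching _) _ _ hR
      (Fintype.card_fin _), rho.parts_sum]
  push_cast
  rfl

theorem IsStructurePolynomial.unique {f g : ℚ[X]} (hf : IsStructurePolynomial lam del rho f)
    (hg : IsStructurePolynomial lam del rho g) : f = g := by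
  refine eq_of_infinite_eval_eq f g ?_
  refine Set.Infinite.mono ?_ ((Set.Ici_infinite (a + b + c)).image
    (Nat.cast_injective (R := ℚ)).injOn)
  rintro _ ⟨n, hn, rfl⟩
  rw [Set.mem_Ici] at hn
  obtain ⟨α, hα, h1⟩ := hf n (by omega) (by omega) (by omega)
  obtain ⟨α', hα', h2⟩ := hg n (by omega) (by omega) (by omega)
  have hαα' : α = α' := (hα' α).1 ((hα α).2 rfl)
  rw [← hαα', h1] at h2
  have hne : (2 ^ n * (n.factorial : ℂ)) ≠ 0 :=
    mul_ne_zero (pow_ne_zero _ two_ne_zero) (Nat.cast_ne_zero.2 n.factorial_ne_zero)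
  exact Rat.cast_injective (mul_left_cancel₀ hne h2)

end Polynomiality

end HyperoctahedralHecke

theorem mainTheorem4 {a b c : ℕ} (lam : a.Partition) (del : b.Partition) (rho : c.Partition)
    (hlam : HyperoctahedralHecke.IsProper lam) (hdel : HyperoctahedralHecke.IsProper del)
    (hrho : HyperoctahedralHecke.IsProper rho) :
    (∃! f : ℚ[X], HyperoctahedralHecke.IsStructurePolynomial lam del rho f) ∧
    ∀ f : ℚ[X], HyperoctahedralHecke.IsStructurePolynomial lam del rho f → f ≠ 0 →
      (f.natDegree : ℤ) ≤ (a : ℤ) + b - c ∧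
      (f.natDegree : ℤ) ≤ (a : ℤ) + b - c - lam.parts.card - del.parts.card + rho.parts.card := by
  have h0 := HyperoctahedralHecke.isStructurePolynomial_structurePolynomial hlam hdel hrho
  refine ⟨⟨_, h0, fun f hf => hf.unique h0⟩, fun f hf hne => ?_⟩
  obtain rfl := hf.unique h0
  have := HyperoctahedralHecke.le_of_structurePolynomial_ne_zero hne
  omega
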